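/- Let $\mathbb U=\{z\in\mathbb C:|z|<1\}$. For functions $g,h$ analytic in $\mathbb U$ write $g\prec h$ ($g$ is subordinate to $h$) if $g=h\circ\omega$ for some analytic $\omega:\mathbb U\to\mathbb U$ with $\omega(0)=0$; "univalent" means analytic and injective in $\mathbb U$. Let $p\ge 1$ be an integer, let $\eta,\mu\in\mathbb C$ be not both zero, and let $\gamma\in\mathbb C\setminus\{0\}$. For $f(z)=z^p+\sum_{k\ge p+1}a_kz^k$ analytic in $\mathbb U$ put $$F_p^{\eta,\mu}[f](z)=\Big(\frac{f'(z)}{p z^{p-1}}\Big)^{\eta}\Big(\frac{z^p}{f(z)}\Big)^{\mu},\qquad F_p^{\eta,\mu}[f](0)=1,$$ where both bases are given the value $1$ at $z=0$ and the powers are the analytic branches in $\mathbb U$ that take their principal value $1$ at $z=0$ (a power with exponent $0$ is $1$). Let $q$ be univalent in $\mathbb U$ with $q(0)=1$ and $$\operatorname{Re}\Big(1+\frac{zq''(z)}{q'(z)}-\frac{zq'(z)}{q(z)}\Big)>0\qquad(z\in\mathbb U).$$ Let $f(z)=z^p+\sum_{k\ge p+1}a_kz^k$ be analytic in $\mathbb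 U$ with $F_p^{\eta,\mu}[f](z)\ne 0$ for all $z\in\mathbb U$; this means that for $z\in\mathbb U\setminus\{0\}$ one has $f'(z)\neq0$ if $\eta\ne0$, and $f(z)\ne0$ if $\mu\neq0$, so that the powers are defined. Suppose that $$1+\gamma\Big[\eta\Big(1-p+\frac{zf''(z)}{f'(z)}\Big)+\mu\Big(p-\frac{zf'(z)}{f(z)}\Big)\Big]\prec 1+\gamma\frac{zq'(z)}{q(z)},\qquad(1)$$ where the left-hand side is given its limit $1$ at $z=0$, and a bracket whose coefficient $\eta$ or $\mu$ is $0$ is omitted. Then $$F_p^{\eta,\mu}[f]\prec q .$$ Moreover, $u=F_p^{\eta,\mu}[f]$ is a solution of the differential subordination $$1+\gamma\,\frac{zu'(z)}{u(z)}\prec 1+\gamma\frac{zq'(z)}{q(z)},\qquad(2)$$ considered for analytic $u:\mathbb U\to\mathbb C\setminus\{0\}$ with $u(0)=1$, and $q$ is the best dominant of (2). That is: the right-hand side of (2) is univalent; $q$ is univalent; $u\prec q$ for every solution $u$ of (2); and $q\prec r$ for every analytic $r$ in $\mathbb U$ such that $u\prec r$ for all solutions $u$ of (2). -/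

import Mathlib

namespace DiffSub

/-- The open unit disc `𝕌 = {z : |z| < 1}`. -/
abbrev disc : Set ℂ := Metric.ball (0 : ℂ) 1

/-- Subordination `g ≺ h` on the unit disc: `g = h ∘ ω` for some analytic `ω : 𝕌 → 𝕌` with
`ω 0 = 0`. -/
def Subordinate (g h : ℂ → ℂ) : Prop :=
  ∃ ω : ℂ → ℂ, DifferentiableOn ℂ ω disc ∧ Set.MapsTo ω disc disc ∧ ω 0 = 0 ∧
    ∀ z ∈ disc, g z = h (ω z)

/-- Univalent on the unit disc: analytic and injective. -/
def Univalent (h : ℂ → ℂ) : Prop :=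
  DifferentiableOn ℂ h disc ∧ Set.InjOn h disc

/-- The class `A_p` of functions `f z = z ^ p + ∑_{k > p} a_k z ^ k` analytic in the unit disc. -/
def ClassA (p : ℕ) (f : ℂ → ℂ) : Prop :=
  ∃ a : ℕ → ℂ, (∀ k < p, a k = 0) ∧ a p = 1 ∧
    ∀ z ∈ disc, HasSum (fun k : ℕ => a k * z ^ k) (f z)

/-- `L` is the analytic logarithm of `g` on the unit disc that is the principal one at the
origin. -/
def IsLogBranch (g L : ℂ → ℂ) : Prop :=
  DifferentiableOn ℂ L disc ∧ L 0 = Complex.log (g 0) ∧ ∀ z ∈ disc, Complex.exp (L z) = g z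

open Classical in
/-- The power `g ^ c` on the unit disc, as the analytic branch that takes the principal value at
the origin. If `g` has no analytic logarithm on the disc (for instance, if `g` has a zero there),
the power is taken pointwise, so that `0 ^ c = 0` for `c ≠ 0` and `g ^ 0 = 1`. -/
noncomputable def branchPow (g : ℂ → ℂ) (c : ℂ) : ℂ → ℂ :=
  if h : ∃ L, IsLogBranch g L then fun z => Complex.exp (c * h.choose z) else fun z => g z ^ c

/-- The analytic logarithm is unique, so `branchPow` does not depend on a choice. -/
theorem branchPow_eq {g L : ℂ → ℂ} (hL : IsLogBranch g L) (c : ℂ) {z : ℂ} (hz : z ∈ disc) :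
    branchPow g c z = Complex.exp (c * L z) := by
  have h : ∃ L, IsLogBranch g L := ⟨L, hL⟩
  have key : ∀ M : ℂ → ℂ, IsLogBranch g M → ∀ w ∈ disc, deriv M w = deriv g w / g w := by
    intro M hM w hw
    have hd := (hM.1.differentiableAt (Metric.isOpen_ball.mem_nhds hw)).hasDerivAt
    have he : (fun x => Complex.exp (M x)) =ᶠ[nhds w] g :=
      Filter.eventually_of_mem (Metric.isOpen_ball.mem_nhds hw) hM.2.2
    have h1 := (hd.cexp.congr_of_eventuallyEq he.symm).deriv
    rw [h1, hM.2.2 w hw]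
    have : g w ≠ 0 := by rw [← hM.2.2 w hw]; exact Complex.exp_ne_zero _
    field_simp
  have hs := h.choose_spec
  have heq : Set.EqOn h.choose L disc :=
    Metric.isOpen_ball.eqOn_of_deriv_eq (convex_ball (0 : ℂ) 1).isPreconnected hs.1 hL.1
      (fun w hw => by rw [key _ hs w hw, key _ hL w hw])
      (Metric.mem_ball_self one_pos) (by rw [hs.2.1, hL.2.1])
  simp only [branchPow, dif_pos h]
  rw [heq hz]

/-- `f' z / (p z ^ (p - 1))`, with its removable singularity at the origin filled in (for
`f ∈ A_p`). -/
noncomputable def derivQuot (p : ℕ) (f : ℂ → ℂ) (z : ℂ) : ℂ :=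
  if z = 0 then 1 else deriv f z / (p * z ^ (p - 1))

/-- `z ^ p / f z`, with its removable singularity at the origin filled in (for `f ∈ A_p`). At a
zero `z ≠ 0` of `f` the value is `0`. -/
noncomputable def powQuot (p : ℕ) (f : ℂ → ℂ) (z : ℂ) : ℂ :=
  if z = 0 then 1 else z ^ p / f z

/-- The operator `F_p^{η,μ}[f] = (f' / (p z ^ (p - 1))) ^ η * (z ^ p / f) ^ μ`, with
`F_p^{η,μ}[f] 0 = 1`. If it has no zero in the disc, then `f'` has no zero `z ≠ 0` there unless
`η = 0`, and `f` has no zero `z ≠ 0` there unless `μ = 0`, so both powers are analytic branches. -/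
noncomputable def opF (p : ℕ) (η μ : ℂ) (f : ℂ → ℂ) (z : ℂ) : ℂ :=
  branchPow (derivQuot p f) η z * branchPow (powQuot p f) μ z

/-- The class `A_0` (for given `p`, `η`, `μ`). -/
def ClassA0 (p : ℕ) (η μ : ℂ) (f : ℂ → ℂ) : Prop :=
  ClassA p f ∧ opF p η μ f 0 = 1 ∧ (η, μ) ≠ (0, 0)

/-- `1 + γ (η (1 - p + z f'' / f') + μ (p - z f' / f))`, with its removable singularity at the
origin filled in: for `f ∈ A_p`, `z f'' / f' → p - 1` and `z f' / f → p` as `z → 0`. -/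
noncomputable def lhsExpr (p : ℕ) (η μ γ : ℂ) (f : ℂ → ℂ) (z : ℂ) : ℂ :=
  if z = 0 then 1
  else 1 + γ * (η * (1 - p + z * deriv (deriv f) z / deriv f z)
    + μ * (p - z * deriv f z / f z))

/-- `u` is a solution of the first-order differential subordination
`ψ (u z, z * u' z; z) ≺ h z`, among the functions `u` analytic in the disc with `u 0 = a` and
with values in the set `Ω` of those `r` for which `ψ (r, s; z)` is defined. -/
def IsSolution (Ω : Set ℂ) (a : ℂ) (ψ : ℂ → ℂ → ℂ → ℂ) (h u : ℂ → ℂ) : Prop :=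
  DifferentiableOn ℂ u disc ∧ u 0 = a ∧ Set.MapsTo u disc Ω ∧
    Subordinate (fun z => ψ (u z) (z * deriv u z) z) h

/-- `q` is a dominant: it is analytic and every solution is subordinate to it. -/
def IsDominant (Ω : Set ℂ) (a : ℂ) (ψ : ℂ → ℂ → ℂ → ℂ) (h q : ℂ → ℂ) : Prop :=
  DifferentiableOn ℂ q disc ∧ ∀ u, IsSolution Ω a ψ h u → Subordinate u q

/-- `q` is the best dominant: the right-hand side `h` is univalent (as it has to be in a
differential subordination), and `q` is a univalent dominant subordinate to every dominant. -/
def IsBestDominant (Ω : Set ℂ) (a : ℂ) (ψ : ℂ → ℂ → ℂ → ℂ) (h q : ℂ → ℂ) : Prop :=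
  Univalent h ∧ Univalent q ∧ IsDominant Ω a ψ h q ∧
    ∀ r, IsDominant Ω a ψ h r → Subordinate q r

end DiffSub

open Metric Set Filter Topology

namespace DiffSub

/-! Logarithmic differentiation of `u = opF p η μ f` turns (1) into (2) (`ClassA.opF_spec`), so
everything reduces to the best dominant of (2). Put Q = z q'/q. The hypothesis on `q` is Re (z Q'/Q)
> 0, i.e. Q is starlike. In the coordinate ζ = log z, log Q has derivative with positive real part
on a convex half-plane; hence Q is injective, and k Q(a) = Q(b) with k ≥ 1 forces |a| ≤ |b|
(`norm_le_of_mul_eq_of_starlike`). Let z u'/u = Q ∘ ω with ω a Schwarz function, and suppose that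
for some R < 1 the image of |z| < R under u is not contained in the image under q. At a point z₀ of
least modulus where this fails, u(z₀) = q(w₀) with |w₀| = R. Jack's lemma for q⁻¹ ∘ u gives z₀
u'(z₀)/u(z₀) = k Q(w₀) with k ≥ 1, so k Q(w₀) = Q(ω(z₀)) and R ≤ |ω(z₀)| ≤ |z₀| < R, a
contradiction. Since only radii R < 1 occur, no boundary regularity of q is needed. Finally, q
itself solves (2), so it is subordinate to every dominant. -/

theorem disc_mem_nhds {z : ℂ} (hz : z ∈ disc) : disc ∈ 𝓝 z := isOpen_ball.mem_nhds hz

theorem zero_mem_disc : (0 : ℂ) ∈ disc := mem_ball_self one_pos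

/-! ### Analytic logarithms and derivatives of injective functions -/

/-- A nonvanishing analytic function on the disc has an analytic logarithm. -/
theorem exists_isLogBranch {g : ℂ → ℂ} (hg : DifferentiableOn ℂ g disc)
    (hg0 : ∀ z ∈ disc, g z ≠ 0) : ∃ L, IsLogBranch g L := by
  obtain ⟨L, hL0, hL⟩ :=
    (((hg.deriv isOpen_ball).div hg hg0).isExactOn_ball).with_val_at 0 (Complex.log (g 0))
  refine ⟨L, fun z hz => (hL z hz).differentiableAt.differentiableWithinAt, hL0, ?_⟩
  have hd : ∀ z ∈ disc, HasDerivAt (fun z => Complex.exp (-L z) * g z) 0 z := by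
    intro z hz
    have hgz := (hg.differentiableAt (disc_mem_nhds hz)).hasDerivAt
    refine ((hL z hz).neg.cexp.mul hgz).congr_deriv ?_
    have := hg0 z hz
    simp only [Pi.div_apply]
    field_simp
    ring
  intro z hz
  have h1 := isOpen_ball.is_const_of_deriv_eq_zero (convex_ball (0 : ℂ) 1).isPreconnected
    (fun z hz => (hd z hz).differentiableAt.differentiableWithinAt)
    (fun z hz => (hd z hz).deriv) hz zero_mem_disc
  simp only [hL0, Complex.exp_neg, Complex.exp_log (hg0 0 zero_mem_disc)] at h1
  rw [inv_mul_cancel₀ (hg0 0 zero_mem_disc)] at h1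
  have := Complex.exp_ne_zero (L z)
  field_simp at h1
  exact h1.symm

/-- An analytic function that is injective near a point has nonzero derivative there. -/
theorem deriv_ne_zero_of_injOn {f : ℂ → ℂ} {a : ℂ} {s : Set ℂ} (hf : AnalyticAt ℂ f a)
    (hs : s ∈ 𝓝 a) (hinj : InjOn f s) : deriv f a ≠ 0 := by
  intro h0
  have hnc : ¬ ∀ᶠ z in 𝓝 a, f z - f a = 0 := by
    intro h
    have h2 : ∀ᶠ z in 𝓝 a, z = a := by
      filter_upwards [h, hs] with z hz hzs
      exact hinj hzs (mem_of_mem_nhds hs) (sub_eq_zero.1 hz)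
    have h3 : ∀ᶠ z in 𝓝[≠] a, z = a := h2.filter_mono nhdsWithin_le_nhds
    obtain ⟨z, hz, hz'⟩ := (h3.and self_mem_nhdsWithin).exists
    exact hz' hz
  have hfa : AnalyticAt ℂ (fun z => f z - f a) a := hf.sub analyticAt_const
  obtain ⟨n, g, hg, hga, hfg⟩ := hfa.exists_eventuallyEq_pow_smul_nonzero_iff.2 hnc
  simp only [smul_eq_mul] at hfg
  have hn0 : n ≠ 0 := by
    rintro rfl
    have := hfg.self_of_nhds
    simp at this
    exact hga this.symm
  have hn1 : n ≠ 1 := by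
    rintro rfl
    have h1 : HasDerivAt (fun z => (z - a) ^ 1 * g z) (g a) a := by
      have := HasDerivAt.fun_mul ((hasDerivAt_id a).sub_const a) hg.differentiableAt.hasDerivAt
      simpa using this
    have h2 := (h1.congr_of_eventuallyEq hfg).deriv
    rw [deriv_sub_const] at h2
    exact hga (h2 ▸ h0)
  have hnC : (n : ℂ) ≠ 0 := Nat.cast_ne_zero.2 hn0
  -- An n-th root of `g` near `a`. Dividing by `g a` moves the argument of the logarithm to 1, away
  -- from the branch cut.
  set k : ℂ → ℂ := fun z => Complex.exp ((Complex.log (g a) + Complex.log (g z / g a)) / n) with hk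
  have hkan : AnalyticAt ℂ k a := by
    refine AnalyticAt.cexp (AnalyticAt.div (analyticAt_const.add
      (AnalyticAt.clog (hg.div analyticAt_const hga) ?_)) analyticAt_const hnC)
    simp [hga]
  have hkn : ∀ᶠ z in 𝓝 a, k z ^ n = g z := by
    filter_upwards [hg.continuousAt.eventually_ne hga] with z hz
    rw [hk, ← Complex.exp_nat_mul, mul_div_cancel₀ _ hnC, Complex.exp_add,
      Complex.exp_log hga, Complex.exp_log (div_ne_zero hz hga), mul_div_cancel₀ _ hga]
  have hh : HasStrictDerivAt (fun z => (z - a) * k z) (k a) a := by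
    have := HasStrictDerivAt.fun_mul ((hasStrictDerivAt_id a).sub_const a) hkan.hasStrictDerivAt
    simpa using this
  have hmap := hh.map_nhds_eq (Complex.exp_ne_zero _)
  simp only [sub_self, zero_mul] at hmap
  set V := {z | f z - f a = (z - a) ^ n * g z ∧ k z ^ n = g z} ∩ s with hV
  have hVn : V ∈ 𝓝 a := inter_mem (hfg.and hkn) hs
  have hW : (fun z => (z - a) * k z) '' V ∈ 𝓝 (0 : ℂ) := hmap ▸ image_mem_map hVn
  -- In the local coordinate w = (z - a) k(z), f - f(a) is wⁿ, so f takes the same value at the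
  -- points with coordinates w and ξw. Injectivity then forces ξ = 1, i.e. n = 1.
  obtain ⟨ξ, hξ⟩ : ∃ ξ : ℂ, IsPrimitiveRoot ξ n := ⟨_, Complex.isPrimitiveRoot_exp n hn0⟩
  have hW2 : ∀ᶠ w in 𝓝 (0 : ℂ), ξ * w ∈ (fun z => (z - a) * k z) '' V := by
    have : Tendsto (fun w : ℂ => ξ * w) (𝓝 0) (𝓝 0) := by
      simpa using (continuous_const_mul ξ).tendsto (0 : ℂ)
    exact this hW
  obtain ⟨w, ⟨⟨z₁, hz₁, h₁⟩, ⟨z₂, hz₂, h₂⟩⟩, hw0⟩ := (((show ∀ᶠ w in 𝓝 (0 : ℂ), _ from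
    hW).and hW2).filter_mono nhdsWithin_le_nhds |>.and (self_mem_nhdsWithin (s := {0}ᶜ))).exists
  simp only at h₁ h₂
  have hf1 : f z₁ - f a = w ^ n := by rw [hz₁.1.1, ← hz₁.1.2, ← mul_pow, h₁]
  have hf2 : f z₂ - f a = w ^ n := by
    rw [hz₂.1.1, ← hz₂.1.2, ← mul_pow, h₂, mul_pow, hξ.pow_eq_one, one_mul]
  have h12 : z₁ = z₂ := hinj hz₁.2 hz₂.2 (by linear_combination hf1 - hf2)
  rw [h12, h₂] at h₁
  have : ξ = 1 := by
    have h3 : (ξ - 1) * w = 0 := by linear_combination h₁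
    rcases mul_eq_zero.1 h3 with h | h
    · exact sub_eq_zero.1 h
    · exact absurd h hw0
  exact hn1 (by rw [hξ.eq_orderOf, this, orderOf_one])

/-! ### Jack's lemma -/

theorem nonpos_of_hasDerivAt_of_le {f : ℝ → ℝ} {f' : ℝ} (hf : HasDerivAt f f' 0)
    (h : ∀ᶠ t in 𝓝[>] (0 : ℝ), f t ≤ f 0) : f' ≤ 0 := by
  refine le_of_tendsto hf.tendsto_slope_zero_right ?_
  filter_upwards [h, self_mem_nhdsWithin] with t ht ht0
  have : 0 < t := ht0
  simp only [zero_add, smul_eq_mul]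
  exact mul_nonpos_of_nonneg_of_nonpos (by positivity) (by linarith)

/-- **Jack's lemma**, for a boundary point at which the function is differentiable. -/
theorem jack_lemma {φ : ℂ → ℂ} {r R : ℝ} {z₀ φ' : ℂ} (hr : 0 < r) (hR : 0 < R)
    (hd : DifferentiableOn ℂ φ (ball 0 r)) (hm : MapsTo φ (ball 0 r) (ball 0 R)) (h0 : φ 0 = 0)
    (hz₀ : ‖z₀‖ = r) (hφz₀ : ‖φ z₀‖ = R) (hφ' : HasDerivAt φ φ' z₀) :
    ∃ k : ℝ, 1 ≤ k ∧ z₀ * φ' = k * φ z₀ := by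
  have hz0 : z₀ ≠ 0 := norm_pos_iff.1 (hz₀ ▸ hr)
  have hp0 : φ z₀ ≠ 0 := norm_pos_iff.1 (hφz₀ ▸ hR)
  set c := z₀ * φ' / φ z₀ with hc
  -- The quotient (φ(z)/φ(z₀))/(z/z₀) is 1 at z₀ and, by Schwarz, of modulus at most 1 inside. So
  -- its real part cannot increase along a segment from z₀ into the disc in direction z₀(-1 + iy).
  have key : ∀ y : ℝ, ((c - 1) * (-1 + y * Complex.I)).re ≤ 0 := by
    intro y
    set d : ℂ := -1 + y * Complex.I with hd'
    have hline : HasDerivAt (fun t : ℝ => z₀ * (1 + t * d)) (z₀ * d) 0 := by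
      have h1 : HasDerivAt (fun t : ℝ => (t : ℂ)) 1 0 := Complex.ofRealCLM.hasDerivAt
      simpa using ((h1.mul_const d).const_add 1).const_mul z₀
    have hm' : HasDerivAt (fun z => (φ z / φ z₀) / (z / z₀)) ((c - 1) / z₀) z₀ := by
      refine ((hφ'.div_const _).div ((hasDerivAt_id z₀).div_const _)
        (by simp [hz0])).congr_deriv ?_
      simp only [id, hc]
      field_simp
    have hcomp : HasDerivAt (fun t : ℝ => (φ (z₀ * (1 + t * d)) / φ z₀) /
        (z₀ * (1 + t * d) / z₀)) ((c - 1) * d) 0 := by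
      have hm'' : HasDerivAt (fun z => (φ z / φ z₀) / (z / z₀)) ((c - 1) / z₀)
        (z₀ * (1 + ((0 : ℝ) : ℂ) * d)) := by simpa using hm'
      refine (HasDerivAt.comp (0 : ℝ) hm'' hline).congr_deriv ?_
      field_simp
    have hre := Complex.reCLM.hasFDerivAt.comp_hasDerivAt (0 : ℝ) hcomp
    refine nonpos_of_hasDerivAt_of_le hre ?_
    -- |1 + td|² = 1 - 2t + t²(1 + y²), which is below 1 for such t.
    have hsmall : ∀ᶠ t in 𝓝[>] (0 : ℝ), t < 1 / (1 + y ^ 2) :=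
      (eventually_lt_nhds (by positivity)).filter_mono nhdsWithin_le_nhds
    filter_upwards [hsmall, self_mem_nhdsWithin] with t ht ht0
    have ht0 : 0 < t := ht0
    have hty : t * (1 + y ^ 2) < 1 := by rwa [lt_div_iff₀ (by positivity)] at ht
    have hlt : ‖1 + t * d‖ < 1 := by
      rw [← sq_lt_one_iff₀ (norm_nonneg _), ← Complex.normSq_eq_norm_sq, Complex.normSq_apply]
      simp [hd']
      nlinarith
    have hmem : z₀ * (1 + t * d) ∈ ball (0 : ℂ) r := by
      rw [mem_ball_zero_iff, norm_mul, hz₀]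
      nlinarith
    have hsch := Complex.dist_le_div_mul_dist_of_mapsTo_ball hd
      (by rw [h0]; exact fun z hz => ball_subset_closedBall (hm hz)) hmem
    rw [h0, dist_zero_right, dist_zero_right, norm_mul, hz₀] at hsch
    have hsch' : ‖φ (z₀ * (1 + t * d))‖ ≤ R * ‖1 + t * d‖ := by
      refine hsch.trans_eq ?_
      field_simp
    have h1 : (φ z₀ / φ z₀ / (z₀ / z₀)).re = 1 := by simp [hz0, hp0]
    simp only [Function.comp_def, Complex.reCLM_apply, Complex.ofReal_zero, zero_mul, add_zero,
      mul_one]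
    rw [h1]
    refine (Complex.re_le_norm _).trans ?_
    rw [mul_div_cancel_left₀ _ hz0, norm_div, norm_div, hφz₀]
    refine div_le_one_of_le₀ ?_ (norm_nonneg _)
    rw [div_le_iff₀ hR]
    linarith
  simp only [Complex.mul_re, Complex.sub_re, Complex.one_re, Complex.sub_im, Complex.one_im,
    Complex.add_re, Complex.add_im, Complex.neg_re, Complex.neg_im, Complex.ofReal_re,
    Complex.ofReal_im, Complex.I_re, Complex.I_im, Complex.mul_im] at key
  have him : c.im = 0 := by
    by_contra hne
    -- For this y the left-hand side of `key` is 3 - Re c + |Re c| > 0.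
    have h1 := key (-(2 + |c.re|) / c.im)
    have h2 : c.im * (-(2 + |c.re|) / c.im) = -(2 + |c.re|) := by field_simp
    have := neg_abs_le c.re
    have := le_abs_self c.re
    linarith
  refine ⟨c.re, ?_, ?_⟩
  · have := key 0
    linarith
  · have : (c.re : ℂ) = c := Complex.ext (by simp) (by simp [him])
    rw [this, hc, div_mul_cancel₀ _ hp0]

/-! ### Starlike functions in the logarithmic coordinate -/

section Starlike

variable {G : ℂ → ℂ}

theorem exp_mem_disc {ζ : ℂ} (hζ : ζ.re < 0) : Complex.exp ζ ∈ disc := by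
  rw [mem_ball_zero_iff, Complex.norm_exp]
  exact Real.exp_lt_one_iff.2 hζ

/-- In the logarithmic coordinate of the left half-plane, the starlike function `z * exp (G z)`
has a derivative with positive real part, so that its difference quotients have as well. -/
theorem re_slope_pos (hG : DifferentiableOn ℂ G disc)
    (hre : ∀ z ∈ disc, 0 < (1 + z * deriv G z).re) {x y : ℂ} (hx : x.re < 0) (hy : y.re < 0)
    (hxy : x ≠ y) :
    0 < (((y + G (Complex.exp y)) - (x + G (Complex.exp x))) / (y - x)).re := by
  have hne : y - x ≠ 0 := sub_ne_zero.2 hxy.symm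
  have hneg : ∀ t ∈ Icc (0 : ℝ) 1, (x + t * (y - x)).re < 0 := by
    intro t ht
    simp only [Complex.add_re, Complex.mul_re, Complex.ofReal_re, Complex.sub_re,
      Complex.ofReal_im, zero_mul, sub_zero]
    rcases eq_or_lt_of_le ht.1 with h | h
    · simp [← h, hx]
    · nlinarith [ht.2]
  have hder : ∀ t ∈ Icc (0 : ℝ) 1, HasDerivAt (fun t : ℝ => (((x + t * (y - x)) +
      G (Complex.exp (x + t * (y - x)))) / (y - x)).re)
      (1 + Complex.exp (x + t * (y - x)) * deriv G (Complex.exp (x + t * (y - x)))).re t := by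
    intro t ht
    have h1 : HasDerivAt (fun t : ℝ => (t : ℂ)) 1 t := Complex.ofRealCLM.hasDerivAt
    have h2 : HasDerivAt (fun t : ℝ => x + (t : ℂ) * (y - x)) (y - x) t := by
      simpa using (h1.mul_const (y - x)).const_add x
    have h3 := (hG.differentiableAt (disc_mem_nhds (exp_mem_disc (hneg t ht)))).hasDerivAt
    have h4 := (h2.add (h3.comp t h2.cexp)).div_const (y - x)
    refine (Complex.reCLM.hasFDerivAt.comp_hasDerivAt t h4).congr_deriv ?_
    simp only [Complex.reCLM_apply]
    congr 1
    field_simp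
  obtain ⟨t, ht, h⟩ := exists_hasDerivAt_eq_slope _ _ one_pos
    (fun t ht => (hder t ht).continuousAt.continuousWithinAt)
    (fun t ht => hder t (Ioo_subset_Icc_self ht))
  have hpos := hre _ (exp_mem_disc (hneg t (Ioo_subset_Icc_self ht)))
  rw [h] at hpos
  simpa [sub_div] using hpos

/-- For nonzero points `a`, `b` of the disc with `k * Q a = Q b`, where `Q z = z * exp (G z)` is
starlike and `1 ≤ k`, either `a = b` and `k = 1`, or `‖a‖ < ‖b‖`. -/
theorem eq_or_norm_lt_of_mul_eq (hG : DifferentiableOn ℂ G disc)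
    (hre : ∀ z ∈ disc, 0 < (1 + z * deriv G z).re) {a b : ℂ} (ha : a ∈ disc) (hb : b ∈ disc)
    (ha0 : a ≠ 0) (hb0 : b ≠ 0) {k : ℝ} (hk : 1 ≤ k)
    (hab : k * (a * Complex.exp (G a)) = b * Complex.exp (G b)) :
    a = b ∨ k ≠ 1 ∧ ‖a‖ < ‖b‖ := by
  have hk0 : (0 : ℝ) < k := by linarith
  have hlog : ∀ w : ℂ, w ∈ disc → w ≠ 0 → (Complex.log w).re < 0 := fun w hw hw0 => by
    rw [Complex.log_re]
    exact Real.log_neg (norm_pos_iff.2 hw0) (mem_ball_zero_iff.1 hw)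
  have hexp : Complex.exp (Real.log k + (Complex.log a + G a)) =
      Complex.exp (Complex.log b + G b) := by
    rw [Complex.exp_add, Complex.exp_add, Complex.exp_add, Complex.exp_log ha0,
      Complex.exp_log hb0, ← Complex.ofReal_exp, Real.exp_log hk0, hab]
  obtain ⟨n, hn⟩ := Complex.exp_eq_exp_iff_exists_int.1 hexp
  set x : ℂ := Complex.log a with hx
  -- The multiple of 2πi is absorbed into the logarithm of b, so that the values of ζ + G(exp ζ) at
  -- y and x differ by exactly log k.
  set y : ℂ := Complex.log b + n * (2 * Real.pi * Complex.I) with hy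
  have hea : Complex.exp x = a := Complex.exp_log ha0
  have heb : Complex.exp y = b := by
    rw [hy, Complex.exp_add, Complex.exp_int_mul_two_pi_mul_I, mul_one, Complex.exp_log hb0]
  have hyre : y.re = (Complex.log b).re := by simp [hy]
  by_cases hxy : x = y
  · left
    rw [← hea, ← heb, hxy]
  · right
    have h := re_slope_pos hG hre (hlog a ha ha0) (hyre ▸ hlog b hb hb0) hxy
    have hdiff : y + G (Complex.exp y) - (x + G (Complex.exp x)) = (Real.log k : ℂ) := by
      rw [hea, heb, hy]
      linear_combination -hn
    rw [hdiff, Complex.div_re, Complex.ofReal_re, Complex.ofReal_im, zero_mul, zero_div, add_zero] at h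
    have hlk := Real.log_nonneg hk
    have hsub : 0 < (y - x).re := by
      by_contra hle
      push Not at hle
      have := div_nonpos_of_nonpos_of_nonneg (mul_nonpos_of_nonneg_of_nonpos hlk hle)
        (Complex.normSq_nonneg (y - x))
      linarith
    refine ⟨?_, ?_⟩
    · rintro rfl
      simp at h
    · rw [← hea, ← heb, Complex.norm_exp, Complex.norm_exp, Real.exp_lt_exp]
      simpa using hsub

theorem injOn_of_starlike (hG : DifferentiableOn ℂ G disc)
    (hre : ∀ z ∈ disc, 0 < (1 + z * deriv G z).re) :
    InjOn (fun z => z * Complex.exp (G z)) disc := by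
  intro a ha b hb hab
  simp only at hab
  by_cases ha0 : a = 0
  · rw [ha0, zero_mul, eq_comm, mul_eq_zero] at hab
    rw [ha0, hab.resolve_right (Complex.exp_ne_zero _)]
  by_cases hb0 : b = 0
  · rw [hb0, zero_mul, mul_eq_zero] at hab
    exact absurd (hab.resolve_right (Complex.exp_ne_zero _)) ha0
  · have := eq_or_norm_lt_of_mul_eq hG hre ha hb ha0 hb0 le_rfl (by simpa using hab)
    simpa using this

theorem norm_le_of_mul_eq_of_starlike (hG : DifferentiableOn ℂ G disc)
    (hre : ∀ z ∈ disc, 0 < (1 + z * deriv G z).re) {a b : ℂ} (ha : a ∈ disc) (hb : b ∈ disc)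
    {k : ℝ} (hk : 1 ≤ k) (hab : k * (a * Complex.exp (G a)) = b * Complex.exp (G b)) :
    ‖a‖ ≤ ‖b‖ := by
  by_cases ha0 : a = 0
  · simp [ha0]
  by_cases hb0 : b = 0
  · have hk0 : (k : ℂ) ≠ 0 := Complex.ofReal_ne_zero.2 (by linarith)
    simp [hb0, ha0, hk0] at hab
  · rcases eq_or_norm_lt_of_mul_eq hG hre ha hb ha0 hb0 hk hab with h | h
    · rw [h]
    · exact h.2.le

end Starlike
-- Univalent functions and the best dominant
theorem Univalent.analyticAt {q : ℂ → ℂ} (hq : Univalent q) {z : ℂ} (hz : z ∈ disc) :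
    AnalyticAt ℂ q z :=
  hq.1.analyticAt (disc_mem_nhds hz)

theorem Univalent.deriv_ne_zero {q : ℂ → ℂ} (hq : Univalent q) {z : ℂ} (hz : z ∈ disc) :
    deriv q z ≠ 0 :=
  deriv_ne_zero_of_injOn (hq.analyticAt hz) (disc_mem_nhds hz) hq.2

/-- If `1 + z q'' / q' - z q' / q` has positive real part for a univalent `q` that does not vanish
at the origin, then `q` has no zeros: the expression has a pole at every zero of `q`. -/
theorem Univalent.ne_zero {q : ℂ → ℂ} (hq : Univalent q) (hq0 : q 0 ≠ 0)
    (hre : ∀ z ∈ disc, 0 < (1 + z * deriv (deriv q) z / deriv q z - z * deriv q z / q z).re)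
    {a : ℂ} (ha : a ∈ disc) : q a ≠ 0 := by
  intro hqa
  have ha0 : a ≠ 0 := by rintro rfl; exact hq0 hqa
  have hda := hq.deriv_ne_zero ha
  have hcont : ContinuousAt (fun t : ℝ => a * (1 + t)) 0 := by fun_prop
  have hat : a * (1 + ((0 : ℝ) : ℂ)) = a := by simp
  have hc1 : ContinuousAt (deriv q) a := (hq.analyticAt ha).deriv.continuousAt
  have hc2 : ContinuousAt (deriv (deriv q)) a := (hq.analyticAt ha).deriv.deriv.continuousAt
  have hc3 : ContinuousAt (dslope q a) a :=
    continuousAt_dslope_same.2 (hq.analyticAt ha).differentiableAt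
  -- The real part of the expression at a(1 + t), multiplied by t, with q written as a t times
  -- `dslope q a`. It tends to -1, although it is positive for small t > 0.
  have hlim : Tendsto (fun t : ℝ => (t * (1 + a * (1 + t) * deriv (deriv q) (a * (1 + t)) /
      deriv q (a * (1 + t))) - (1 + t) * deriv q (a * (1 + t)) /
        dslope q a (a * (1 + t))).re) (𝓝[>] 0) (𝓝 (-1)) := by
    have : ContinuousAt (fun t : ℝ => (t * (1 + a * (1 + t) * deriv (deriv q) (a * (1 + t)) /
      deriv q (a * (1 + t))) - (1 + t) * deriv q (a * (1 + t)) /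
        dslope q a (a * (1 + t))).re) 0 := by
      have h1 : ContinuousAt (fun t : ℝ => deriv q (a * (1 + t))) 0 :=
        ContinuousAt.comp (g := deriv q) (f := fun t : ℝ => a * (1 + (t : ℂ))) (hat.symm ▸ hc1) hcont
      have h2 : ContinuousAt (fun t : ℝ => deriv (deriv q) (a * (1 + t))) 0 :=
        ContinuousAt.comp (g := deriv (deriv q)) (f := fun t : ℝ => a * (1 + (t : ℂ))) (hat.symm ▸ hc2)
          hcont
      have h3 : ContinuousAt (fun t : ℝ => dslope q a (a * (1 + t))) 0 :=
        ContinuousAt.comp (f := fun t : ℝ => a * (1 + (t : ℂ))) (hat.symm ▸ hc3) hcont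
      have h4 : ContinuousAt (fun t : ℝ => (t : ℂ)) 0 := by fun_prop
      refine Complex.continuous_re.continuousAt.comp (ContinuousAt.sub (h4.mul
        (continuousAt_const.add ((hcont.mul h2).div h1 (by simpa using hda))))
        (((continuousAt_const.add h4).mul h1).div h3 (by simpa using hda)))
    have h := this.tendsto.mono_left (nhdsWithin_le_nhds (s := Ioi 0))
    simpa [hda] using h
  have hmem : ∀ᶠ t : ℝ in 𝓝[>] 0, a * (1 + t) ∈ disc :=
    (hcont.eventually_mem (hat.symm ▸ disc_mem_nhds ha)).filter_mono nhdsWithin_le_nhds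
  have : (0 : ℝ) ≤ -1 := by
    refine ge_of_tendsto hlim ?_
    filter_upwards [hmem, self_mem_nhdsWithin] with t ht ht0
    have ht0 : 0 < t := ht0
    have htC : (t : ℂ) ≠ 0 := Complex.ofReal_ne_zero.2 ht0.ne'
    have hne : a * (1 + t) ≠ a := by simp [mul_add, ha0, ht0.ne']
    have hds : q (a * (1 + t)) = a * t * dslope q a (a * (1 + t)) := by
      have := sub_smul_dslope q a (a * (1 + t))
      rw [hqa, sub_zero, smul_eq_mul] at this
      rw [← this]
      ring
    have hpos := mul_pos ht0 (hre _ ht)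
    rw [← Complex.re_ofReal_mul, hds] at hpos
    refine hpos.le.trans_eq (congrArg Complex.re ?_)
    -- Where the slope vanishes so does q, and both quotients are 0 by convention.
    by_cases hd0 : dslope q a (a * (1 + t)) = 0
    · simp [hd0]
    · rw [mul_sub]
      congr 1
      field_simp
  linarith

/-- For a univalent zero-free `q`, the function `z q' / q` is `z * exp (G z)` with an analytic
`G` such that `1 + z G' = 1 + z q'' / q' - z q' / q`. -/
theorem Univalent.exists_mul_exp_eq {q : ℂ → ℂ} (hq : Univalent q)
    (hq0 : ∀ z ∈ disc, q z ≠ 0) : ∃ G : ℂ → ℂ, DifferentiableOn ℂ G disc ∧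
      (∀ z ∈ disc, z * deriv q z / q z = z * Complex.exp (G z)) ∧
      ∀ z ∈ disc, 1 + z * deriv G z =
        1 + z * deriv (deriv q) z / deriv q z - z * deriv q z / q z := by
  obtain ⟨G, hG⟩ := exists_isLogBranch ((hq.1.deriv isOpen_ball).div hq.1 hq0)
    (fun z hz => div_ne_zero (hq.deriv_ne_zero hz) (hq0 z hz))
  refine ⟨G, hG.1, fun z hz => ?_, fun z hz => ?_⟩
  · rw [hG.2.2 z hz, Pi.div_apply, mul_div_assoc]
  · have h1 := (hG.1.differentiableAt (disc_mem_nhds hz)).hasDerivAt.cexp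
    have h2 : HasDerivAt (deriv q / q) _ z :=
      (hq.analyticAt hz).deriv.differentiableAt.hasDerivAt.div
      (hq.analyticAt hz).differentiableAt.hasDerivAt (hq0 z hz)
    have h3 := (h1.congr_of_eventuallyEq
      (eventually_of_mem (disc_mem_nhds hz) fun w hw => (hG.2.2 w hw).symm)).unique h2
    rw [hG.2.2 z hz, Pi.div_apply] at h3
    have hq0z := hq0 z hz
    have hdq := hq.deriv_ne_zero hz
    have h4 : deriv G z = deriv (deriv q) z / deriv q z - deriv q z / q z := by
      field_simp at h3 ⊢
      linear_combination h3
    rw [h4]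
    ring

/-- Global injectivity makes `Function.invFunOn` a left inverse on the whole disc, so it agrees with
the local inverse at every image point and q⁻¹ ∘ u needs no patching. -/
theorem Univalent.hasDerivAt_invFunOn {q : ℂ → ℂ} (hq : Univalent q) {w : ℂ} (hw : w ∈ disc) :
    HasDerivAt (Function.invFunOn q disc) (deriv q w)⁻¹ (q w) :=
  ((hq.analyticAt hw).hasStrictDerivAt.to_local_left_inverse (hq.deriv_ne_zero hw)
    (eventually_of_mem (disc_mem_nhds hw) fun _ hx => hq.2.leftInvOn_invFunOn hx)).hasDerivAt

theorem Univalent.isOpen_image {q : ℂ → ℂ} (hq : Univalent q) {s : Set ℂ} (hs : s ⊆ disc)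
    (hso : IsOpen s) : IsOpen (q '' s) := by
  rw [isOpen_iff_mem_nhds]
  rintro _ ⟨z, hz, rfl⟩
  rw [← (hq.analyticAt (hs hz)).hasStrictDerivAt.map_nhds_eq (hq.deriv_ne_zero (hs hz))]
  exact image_mem_map (hso.mem_nhds hz)

theorem closedBall_subset_disc {R : ℝ} (hR : R < 1) : closedBall (0 : ℂ) R ⊆ disc :=
  closedBall_subset_ball hR

theorem norm_le_of_mapsTo_disc {ω : ℂ → ℂ} (hω : DifferentiableOn ℂ ω disc)
    (hm : MapsTo ω disc disc) (h0 : ω 0 = 0) {z : ℂ} (hz : z ∈ disc) : ‖ω z‖ ≤ ‖z‖ :=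
  Complex.norm_le_norm_of_mapsTo_ball hω (hm.mono_right ball_subset_closedBall) h0
    (mem_ball_zero_iff.1 hz)

/-- If `z u' / u = Q ∘ ω` for a Schwarz function `ω`, where `Q = z q' / q` is starlike, then `u`
maps every disc of radius `R < 1` into the image of that disc under `q`. -/
theorem Univalent.mapsTo_of_logDeriv_eq {q u ω : ℂ → ℂ} (hq : Univalent q)
    (hstar : ∀ a ∈ disc, ∀ b ∈ disc, ∀ k : ℝ, 1 ≤ k →
      k * (a * deriv q a / q a) = b * deriv q b / q b → ‖a‖ ≤ ‖b‖)
    (hu : DifferentiableOn ℂ u disc) (hu0 : u 0 = q 0) (hω : DifferentiableOn ℂ ω disc)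
    (hωm : MapsTo ω disc disc) (hω0 : ω 0 = 0)
    (huq : ∀ z ∈ disc, z * deriv u z / u z = ω z * deriv q (ω z) / q (ω z))
    {R : ℝ} (hR : R < 1) : MapsTo u (ball 0 R) (q '' ball 0 R) := by
  intro z₁ hz₁
  by_contra hbad
  have hz₁' : ‖z₁‖ < R := mem_ball_zero_iff.1 hz₁
  have hR0 : 0 < R := (norm_nonneg _).trans_lt hz₁'
  have hRd : ball (0 : ℂ) R ⊆ disc := ball_subset_ball hR.le
  have hopen := hq.isOpen_image hRd isOpen_ball
  have hcont : ContinuousOn u (closedBall 0 ‖z₁‖) :=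
    hu.continuousOn.mono (closedBall_subset_disc (hz₁'.trans hR))
  have hcomp : IsCompact (closedBall (0 : ℂ) ‖z₁‖ ∩ u ⁻¹' (q '' ball 0 R)ᶜ) :=
    (isCompact_closedBall 0 ‖z₁‖).of_isClosed_subset
      (hcont.preimage_isClosed_of_isClosed isClosed_closedBall hopen.isClosed_compl)
      inter_subset_left
  obtain ⟨z₀, ⟨hz₀, hbad₀⟩, hmin⟩ := hcomp.exists_isMinOn ⟨z₁, by simp, hbad⟩
    continuous_norm.continuousOn
  have hz₀R : ‖z₀‖ < R := (mem_closedBall_zero_iff.1 hz₀).trans_lt hz₁'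
  have hz₀d : z₀ ∈ disc := hRd (mem_ball_zero_iff.2 hz₀R)
  -- By minimality of |z₀|, no point of smaller modulus is bad.
  have hgood : ∀ z ∈ ball (0 : ℂ) ‖z₀‖, u z ∈ q '' ball 0 R := by
    intro z hz
    by_contra h
    have hz' := mem_ball_zero_iff.1 hz
    have := hmin (show z ∈ closedBall (0 : ℂ) ‖z₁‖ ∩ u ⁻¹' (q '' ball 0 R)ᶜ from
      ⟨mem_closedBall_zero_iff.2 (hz'.le.trans (mem_closedBall_zero_iff.1 hz₀)), h⟩)
    exact absurd hz' (not_lt.2 this)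
  have hz₀0 : z₀ ≠ 0 := by
    rintro rfl
    exact hbad₀ ⟨0, mem_ball_self hR0, hu0.symm⟩
  have hz₀pos : 0 < ‖z₀‖ := norm_pos_iff.2 hz₀0
  -- u(z₀) is a limit of good values, and the image of the closed ball is compact, hence closed.
  have hbdry : u z₀ ∈ q '' closedBall 0 R := by
    have hcl : IsClosed (q '' closedBall 0 R) := ((isCompact_closedBall 0 R).image_of_continuousOn
      (hq.1.continuousOn.mono (closedBall_subset_disc hR))).isClosed
    have hz₀c : z₀ ∈ closure (ball (0 : ℂ) ‖z₀‖) := by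
      rw [closure_ball _ hz₀pos.ne']
      simp
    have := ((hu.continuousOn z₀ hz₀d).mono (ball_subset_ball
      (mem_ball_zero_iff.1 hz₀d).le)).mem_closure hz₀c hgood
    exact hcl.closure_subset_iff.2 (image_mono ball_subset_closedBall) this
  obtain ⟨w₀, hw₀, hqw₀⟩ := hbdry
  have hw₀d := closedBall_subset_disc hR hw₀
  have hw₀R : ‖w₀‖ = R := by
    refine le_antisymm (mem_closedBall_zero_iff.1 hw₀) (not_lt.1 fun h => hbad₀ ?_)
    exact ⟨w₀, mem_ball_zero_iff.2 h, hqw₀⟩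
  set φ : ℂ → ℂ := fun z => Function.invFunOn q disc (u z) with hφ
  have hud : ∀ z ∈ disc, HasDerivAt u (deriv u z) z := fun z hz =>
    (hu.differentiableAt (disc_mem_nhds hz)).hasDerivAt
  have hφd : ∀ z ∈ disc, ∀ w ∈ disc, q w = u z →
      HasDerivAt φ ((deriv q w)⁻¹ * deriv u z) z := by
    intro z hz w hw hwz
    exact HasDerivAt.comp z (hwz ▸ hq.hasDerivAt_invFunOn hw) (hud z hz)
  have hφv : ∀ z, ∀ w ∈ disc, q w = u z → φ z = w := by
    intro z w hw hwz
    rw [hφ]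
    simp only
    rw [← hwz]
    exact hq.2.leftInvOn_invFunOn hw
  have hsub : ball (0 : ℂ) ‖z₀‖ ⊆ disc := ball_subset_ball (mem_ball_zero_iff.1 hz₀d).le
  obtain ⟨k, hk, hjack⟩ := jack_lemma (φ := φ) hz₀pos hR0
    (fun z hz => by
      obtain ⟨w, hw, hwz⟩ := hgood z hz
      exact (hφd z (hsub hz) w (hRd hw) hwz).differentiableAt.differentiableWithinAt)
    (fun z hz => by
      obtain ⟨w, hw, hwz⟩ := hgood z hz
      rwa [hφv z w (hRd hw) hwz])
    (hφv 0 0 zero_mem_disc hu0.symm) rfl (by rw [hφv z₀ w₀ hw₀d hqw₀, hw₀R])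
    (hφd z₀ hz₀d w₀ hw₀d hqw₀)
  rw [hφv z₀ w₀ hw₀d hqw₀] at hjack
  have hdw := hq.deriv_ne_zero hw₀d
  have hz₀u : z₀ * deriv u z₀ = k * (w₀ * deriv q w₀) := by
    field_simp at hjack
    linear_combination hjack
  have h := hstar w₀ hw₀d (ω z₀) (hωm hz₀d) k hk (by
    rw [← huq z₀ hz₀d, hz₀u, ← hqw₀, ← mul_div_assoc])
  have := norm_le_of_mapsTo_disc hω hωm hω0 hz₀d
  linarith

/-- The Schwarz function is q⁻¹ ∘ u; letting R tend to 1 puts all values of u in the image of q. -/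
theorem Univalent.subordinate_of_forall_mapsTo {q u : ℂ → ℂ} (hq : Univalent q)
    (hu : DifferentiableOn ℂ u disc) (hu0 : u 0 = q 0)
    (hm : ∀ R < 1, MapsTo u (ball 0 R) (q '' ball 0 R)) : Subordinate u q := by
  have hmem : ∀ z ∈ disc, ∃ w ∈ disc, q w = u z := by
    intro z hz
    obtain ⟨R, hzR, hR⟩ := exists_between (mem_ball_zero_iff.1 hz)
    obtain ⟨w, hw, hwz⟩ := hm R hR (mem_ball_zero_iff.2 hzR)
    exact ⟨w, ball_subset_ball hR.le hw, hwz⟩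
  refine ⟨fun z => Function.invFunOn q disc (u z), fun z hz => ?_, fun z hz => ?_, ?_,
    fun z hz => ?_⟩
  · obtain ⟨w, hw, hwz⟩ := hmem z hz
    exact (HasDerivAt.comp z (hwz ▸ hq.hasDerivAt_invFunOn hw)
      (hu.differentiableAt (disc_mem_nhds hz)).hasDerivAt).differentiableAt.differentiableWithinAt
  · exact Function.invFunOn_mem (hmem z hz)
  · simp only
    rw [hu0]
    exact hq.2.leftInvOn_invFunOn zero_mem_disc
  · exact (Function.invFunOn_eq (hmem z hz)).symm

/-- The best dominant of `1 + γ z u' / u ≺ 1 + γ z q' / q` is `q`. -/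
theorem Univalent.isBestDominant {q : ℂ → ℂ} {γ : ℂ} (hγ : γ ≠ 0) (hq : Univalent q)
    (hq0 : q 0 = 1) (hre : ∀ z ∈ disc,
      0 < (1 + z * deriv (deriv q) z / deriv q z - z * deriv q z / q z).re) :
    IsBestDominant {0}ᶜ 1 (fun r s _ => 1 + γ * (s / r))
      (fun z => 1 + γ * (z * deriv q z / q z)) q := by
  have hqne : ∀ z ∈ disc, q z ≠ 0 := fun z hz => hq.ne_zero (by simp [hq0]) hre hz
  obtain ⟨G, hG, hQ, hGre⟩ := hq.exists_mul_exp_eq hqne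
  have hre' : ∀ z ∈ disc, 0 < (1 + z * deriv G z).re := fun z hz => hGre z hz ▸ hre z hz
  have hstar : ∀ a ∈ disc, ∀ b ∈ disc, ∀ k : ℝ, 1 ≤ k →
      k * (a * deriv q a / q a) = b * deriv q b / q b → ‖a‖ ≤ ‖b‖ := by
    intro a ha b hb k hk hab
    rw [hQ a ha, hQ b hb] at hab
    exact norm_le_of_mul_eq_of_starlike hG hre' ha hb hk hab
  refine ⟨⟨?_, ?_⟩, hq, ⟨hq.1, ?_⟩, ?_⟩
  · exact (differentiableOn_const _).add ((differentiableOn_const _).mul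
      ((differentiableOn_id.mul (hq.1.deriv isOpen_ball)).div hq.1 hqne))
  · intro a ha b hb hab
    have h := mul_left_cancel₀ hγ (add_left_cancel hab)
    rw [hQ a ha, hQ b hb] at h
    exact injOn_of_starlike hG hre' ha hb h
  · rintro u ⟨hu, hu0, -, ω, hω, hωm, hω0, hωu⟩
    refine hq.subordinate_of_forall_mapsTo hu (hu0.trans hq0.symm) fun R hR =>
      hq.mapsTo_of_logDeriv_eq hstar hu (hu0.trans hq0.symm) hω hωm hω0 (fun z hz => ?_) hR
    exact mul_left_cancel₀ hγ (add_left_cancel (hωu z hz))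
  · rintro r ⟨-, hr⟩
    -- q solves (2) with the identity as Schwarz function.
    exact hr q ⟨hq.1, hq0, hqne, id, differentiableOn_id, mapsTo_id _, rfl, fun _ _ => rfl⟩

/-! ### The operator and its logarithmic derivative -/

section Operator

variable {p : ℕ} {f : ℂ → ℂ}

theorem differentiableOn_tsum_of_summable {a : ℕ → ℂ}
    (ha : ∀ z ∈ disc, Summable fun k => a k * z ^ k) :
    DifferentiableOn ℂ (fun z => ∑' k, a k * z ^ k) disc := by
  intro z hz
  obtain ⟨r, hzr, hr⟩ := exists_between (mem_ball_zero_iff.1 hz)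
  obtain ⟨s, hrs, hs⟩ := exists_between hr
  have hr0 : 0 ≤ r := (norm_nonneg _).trans hzr.le
  have hs0 : 0 < s := hr0.trans_lt hrs
  have hsd : (s : ℂ) ∈ disc := by
    rw [mem_ball_zero_iff, Complex.norm_of_nonneg hs0.le]
    exact hs
  obtain ⟨C, hC⟩ := (ha s hsd).tendsto_atTop_zero.norm.bddAbove_range
  -- Convergence at s > r bounds the terms there, which gives a geometric majorant of ratio r/s on
  -- the ball of radius r.
  have hbound : ∀ k, ‖a k‖ * s ^ k ≤ C := fun k => by
    have := hC ⟨k, rfl⟩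
    simpa [abs_of_pos hs0] using this
  have hsum : Summable fun k : ℕ => C * (r / s) ^ k :=
    (summable_geometric_of_lt_one (by positivity) ((div_lt_one hs0).2 hrs)).mul_left C
  have hd : DifferentiableOn ℂ (fun z => ∑' k, a k * z ^ k) (ball 0 r) := by
    refine Complex.differentiableOn_tsum_of_summable_norm hsum (fun k => by fun_prop) isOpen_ball
      fun k w hw => ?_
    rw [norm_mul, norm_pow, div_pow]
    have hw' : ‖w‖ ^ k ≤ r ^ k := by
      gcongr
      exact (mem_ball_zero_iff.1 hw).le
    calc ‖a k‖ * ‖w‖ ^ k ≤ ‖a k‖ * r ^ k := by gcongr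
      _ = ‖a k‖ * s ^ k * (r ^ k / s ^ k) := by field_simp
      _ ≤ C * (r ^ k / s ^ k) := by gcongr; exact hbound k
  exact (hd.differentiableAt (isOpen_ball.mem_nhds
    (mem_ball_zero_iff.2 hzr))).differentiableWithinAt

/-- Dividing out z^p exposes the removable singularities: `derivQuot` becomes g + z g'/p and
`powQuot` becomes 1/g. -/
theorem ClassA.exists_eq_pow_mul (hf : ClassA p f) : ∃ g : ℂ → ℂ,
    DifferentiableOn ℂ g disc ∧ g 0 = 1 ∧ ∀ z ∈ disc, f z = z ^ p * g z := by
  obtain ⟨a, ha, hap, hs⟩ := hf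
  have hshift : ∀ z ∈ disc, HasSum (fun k => a (k + p) * z ^ (k + p)) (f z) := by
    intro z hz
    rw [hasSum_nat_add_iff (f := fun k => a k * z ^ k) p, Finset.sum_eq_zero, add_zero]
    · exact hs z hz
    · intro i hi
      simp [ha i (Finset.mem_range.1 hi)]
  have hsum : ∀ z ∈ disc, Summable fun k => a (k + p) * z ^ k := by
    intro z hz
    by_cases hz0 : z = 0
    · rw [hz0]
      exact summable_of_ne_finset_zero (s := {0}) fun k hk => by
        simp only [Finset.mem_singleton] at hk
        simp [hk]
    · refine ((hshift z hz).summable.mul_left ((z ^ p)⁻¹)).congr fun k => ?_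
      rw [pow_add]
      field_simp
  refine ⟨_, differentiableOn_tsum_of_summable hsum, ?_, fun z hz => ?_⟩
  · rw [tsum_eq_single 0 fun k hk => by simp [hk]]
    simp [hap]
  · rw [← tsum_mul_left, ← (hshift z hz).tsum_eq]
    refine tsum_congr fun k => ?_
    ring

theorem ne_zero_of_branchPow_ne_zero {g : ℂ → ℂ} {c z : ℂ} (hc : c ≠ 0) (hz : z ∈ disc)
    (h : branchPow g c z ≠ 0) : g z ≠ 0 := by
  by_cases hL : ∃ L, IsLogBranch g L
  · obtain ⟨L, hL⟩ := hL
    exact hL.2.2 z hz ▸ Complex.exp_ne_zero _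
  · rintro h0
    simp [branchPow, dif_neg hL, h0, hc] at h

/-- A power `g ^ c` is `exp A` with an analytic `A` such that `A' = c * g' / g`. -/
theorem exists_branchPow_eq_exp {g : ℂ → ℂ} {c : ℂ}
    (hg : c ≠ 0 → DifferentiableOn ℂ g disc ∧ ∀ z ∈ disc, g z ≠ 0) :
    ∃ A : ℂ → ℂ, ∀ z ∈ disc, branchPow g c z = Complex.exp (A z) ∧
      HasDerivAt A (c * (deriv g z / g z)) z := by
  by_cases hc : c = 0
  · refine ⟨fun _ => 0, fun z _ => ⟨?_, ?_⟩⟩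
    -- With exponent 0 both cases of the definition give 1, so nothing is required of g.
    · by_cases hL : ∃ L, IsLogBranch g L <;> simp [branchPow, hL, hc]
    · simpa [hc] using hasDerivAt_const z (0 : ℂ)
  · obtain ⟨hgd, hg0⟩ := hg hc
    obtain ⟨L, hL⟩ := exists_isLogBranch hgd hg0
    refine ⟨fun z => c * L z, fun z hz => ⟨branchPow_eq hL c hz, HasDerivAt.const_mul c ?_⟩⟩
    have h1 := (hL.1.differentiableAt (disc_mem_nhds hz)).hasDerivAt
    have h2 := (h1.cexp.congr_of_eventuallyEq (eventually_of_mem (disc_mem_nhds hz)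
      fun w hw => (hL.2.2 w hw).symm)).deriv
    rw [hL.2.2 z hz] at h2
    rwa [h2, mul_div_cancel_left₀ _ (hg0 z hz)]

theorem differentiableOn_of_eq_pow_mul {g : ℂ → ℂ} (hg : DifferentiableOn ℂ g disc)
    (hfg : ∀ z ∈ disc, f z = z ^ p * g z) : DifferentiableOn ℂ f disc :=
  ((differentiableOn_id.pow p).mul hg).congr hfg

theorem ClassA.differentiableOn_derivQuot (hf : ClassA p f) (hp : 1 ≤ p) :
    DifferentiableOn ℂ (derivQuot p f) disc := by
  obtain ⟨g, hg, hg0, hfg⟩ := hf.exists_eq_pow_mul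
  have hpC : (p : ℂ) ≠ 0 := Nat.cast_ne_zero.2 (by omega)
  have : DifferentiableOn ℂ (fun z => g z + z * deriv g z / p) disc :=
    hg.add ((differentiableOn_id.mul (hg.deriv isOpen_ball)).div_const _)
  refine this.congr fun z hz => ?_
  by_cases hz0 : z = 0
  · simp [derivQuot, hz0, hg0]
  · rw [derivQuot, if_neg hz0]
    have h1 := ((hasDerivAt_pow p z).mul
      (hg.differentiableAt (disc_mem_nhds hz)).hasDerivAt).congr_of_eventuallyEq
      (eventually_of_mem (disc_mem_nhds hz) hfg)
    obtain ⟨m, rfl⟩ : ∃ m, p = m + 1 := ⟨p - 1, by omega⟩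
    rw [h1.deriv]
    simp only [Nat.add_sub_cancel]
    field_simp
    ring

theorem ClassA.differentiableOn_powQuot (hf : ClassA p f)
    (h0 : ∀ z ∈ disc, powQuot p f z ≠ 0) : DifferentiableOn ℂ (powQuot p f) disc := by
  obtain ⟨g, hg, hg0, hfg⟩ := hf.exists_eq_pow_mul
  -- This also holds at zeros of g, where both sides are 0; nonvanishing of `powQuot` therefore
  -- excludes such zeros.
  have heq : ∀ z ∈ disc, powQuot p f z = (g z)⁻¹ := by
    intro z hz
    by_cases hz0 : z = 0
    · simp [powQuot, hz0, hg0]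
    · rw [powQuot, if_neg hz0, hfg z hz]
      field_simp
  refine DifferentiableOn.congr (hg.inv fun z hz hgz => h0 z hz ?_) heq
  simp [heq z hz, hgz]

theorem mul_deriv_derivQuot_div (hf : DifferentiableOn ℂ f disc) (hp : 1 ≤ p) {z : ℂ}
    (hz : z ∈ disc) (hz0 : z ≠ 0) (h0 : derivQuot p f z ≠ 0) :
    z * (deriv (derivQuot p f) z / derivQuot p f z) =
      1 - p + z * deriv (deriv f) z / deriv f z := by
  have hpC : (p : ℂ) ≠ 0 := Nat.cast_ne_zero.2 (by omega)
  have hf0 : deriv f z ≠ 0 := by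
    intro h
    simp [derivQuot, hz0, h] at h0
  obtain ⟨m, rfl⟩ : ∃ m, p = m + 1 := ⟨p - 1, by omega⟩
  have h1 := ((hf.deriv isOpen_ball).differentiableAt (disc_mem_nhds hz)).hasDerivAt.div
    ((hasDerivAt_pow m z).const_mul ((m + 1 : ℕ) : ℂ)) (mul_ne_zero hpC (pow_ne_zero m hz0))
  have h2 := (h1.congr_of_eventuallyEq (f₁ := derivQuot (m + 1) f) (by
    filter_upwards [eventually_ne_nhds hz0] with w hw
    simp [derivQuot, hw])).deriv
  rw [h2, derivQuot, if_neg hz0]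
  simp only [Nat.add_sub_cancel]
  -- The derivative of z^m carries the truncated exponent m - 1, so m = 0 is separate.
  rcases m with _ | m
  · simp
    field_simp
  · simp only [Nat.add_sub_cancel]
    push_cast at hpC ⊢
    field_simp
    ring

theorem mul_deriv_powQuot_div (hf : DifferentiableOn ℂ f disc) {z : ℂ}
    (hz : z ∈ disc) (hz0 : z ≠ 0) (h0 : powQuot p f z ≠ 0) :
    z * (deriv (powQuot p f) z / powQuot p f z) = p - z * deriv f z / f z := by
  have hf0 : f z ≠ 0 := by
    intro h
    simp [powQuot, hz0, h] at h0
  have h1 := (hasDerivAt_pow p z).div (hf.differentiableAt (disc_mem_nhds hz)).hasDerivAt hf0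
  have h2 := (h1.congr_of_eventuallyEq (f₁ := powQuot p f) (by
    filter_upwards [eventually_ne_nhds hz0] with w hw
    simp [powQuot, hw])).deriv
  rw [h2, powQuot, if_neg hz0]
  rcases p with _ | m
  · simp
    field_simp
  · simp only [Nat.add_sub_cancel]
    field_simp
    ring

/-- The operator `F_p^{η,μ}[f]` is analytic, and `1 + γ z F' / F` is the expression in `f`. -/
theorem ClassA.opF_spec (hf : ClassA p f) (hp : 1 ≤ p) {η μ : ℂ}
    (hF : ∀ z ∈ disc, opF p η μ f z ≠ 0) (γ : ℂ) :
    DifferentiableOn ℂ (opF p η μ f) disc ∧ ∀ z ∈ disc,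
      1 + γ * (z * deriv (opF p η μ f) z / opF p η μ f z) = lhsExpr p η μ γ f z := by
  have hfd : DifferentiableOn ℂ f disc := by
    obtain ⟨g, hg, -, hfg⟩ := hf.exists_eq_pow_mul
    exact differentiableOn_of_eq_pow_mul hg hfg
  have hD : η ≠ 0 → ∀ z ∈ disc, derivQuot p f z ≠ 0 := fun hη z hz =>
    ne_zero_of_branchPow_ne_zero hη hz (left_ne_zero_of_mul (hF z hz))
  have hP : μ ≠ 0 → ∀ z ∈ disc, powQuot p f z ≠ 0 := fun hμ z hz =>
    ne_zero_of_branchPow_ne_zero hμ hz (right_ne_zero_of_mul (hF z hz))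
  obtain ⟨A, hA⟩ := exists_branchPow_eq_exp (g := derivQuot p f) (c := η)
    fun hη => ⟨hf.differentiableOn_derivQuot hp, hD hη⟩
  obtain ⟨B, hB⟩ := exists_branchPow_eq_exp (g := powQuot p f) (c := μ)
    fun hμ => ⟨hf.differentiableOn_powQuot (hP hμ), hP hμ⟩
  have heq : ∀ z ∈ disc, opF p η μ f z = Complex.exp (A z + B z) := fun z hz => by
    rw [opF, (hA z hz).1, (hB z hz).1, Complex.exp_add]
  have hder : ∀ z ∈ disc, HasDerivAt (opF p η μ f) (opF p η μ f z *
      (η * (deriv (derivQuot p f) z / derivQuot p f z) +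
        μ * (deriv (powQuot p f) z / powQuot p f z))) z := fun z hz => by
    rw [heq z hz]
    exact ((hA z hz).2.add (hB z hz).2).cexp.congr_of_eventuallyEq
      (eventually_of_mem (disc_mem_nhds hz) heq)
  refine ⟨fun z hz => (hder z hz).differentiableAt.differentiableWithinAt, fun z hz => ?_⟩
  -- At the origin the factor z kills the logarithmic derivative, matching the filled-in value 1.
  by_cases hz0 : z = 0
  · simp [lhsExpr, hz0]
  · rw [lhsExpr, if_neg hz0, (hder z hz).deriv, mul_left_comm, mul_div_cancel_left₀ _ (hF z hz),
      mul_add, mul_left_comm z η, mul_left_comm z μ]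
    have h1 : η * (z * (deriv (derivQuot p f) z / derivQuot p f z)) =
        η * (1 - p + z * deriv (deriv f) z / deriv f z) := by
      by_cases hη : η = 0
      · simp [hη]
      · rw [mul_deriv_derivQuot_div hfd hp hz hz0 (hD hη z hz)]
    have h2 : μ * (z * (deriv (powQuot p f) z / powQuot p f z)) =
        μ * (p - z * deriv f z / f z) := by
      by_cases hμ : μ = 0
      · simp [hμ]
      · rw [mul_deriv_powQuot_div hfd hz hz0 (hP hμ z hz)]
    rw [h1, h2]

end Operator

end DiffSub

theorem mainTheorem1 (p : ℕ) (hp : 1 ≤ p) (η μ γ : ℂ) (hγ : γ ≠ 0)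
    (q : ℂ → ℂ) (hq : DiffSub.Univalent q) (hq0 : q 0 = 1)
    (hqre : ∀ z ∈ DiffSub.disc,
      0 < (1 + z * deriv (deriv q) z / deriv q z - z * deriv q z / q z).re)
    (f : ℂ → ℂ) (hf : DiffSub.ClassA0 p η μ f)
    (hF : ∀ z ∈ DiffSub.disc, DiffSub.opF p η μ f z ≠ 0)
    (hsub : DiffSub.Subordinate (DiffSub.lhsExpr p η μ γ f)
      (fun z => 1 + γ * (z * deriv q z / q z))) :
    DiffSub.Subordinate (DiffSub.opF p η μ f) q ∧
      DiffSub.IsSolution {0}ᶜ 1 (fun r s _ => 1 + γ * (s / r))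
        (fun z => 1 + γ * (z * deriv q z / q z)) (DiffSub.opF p η μ f) ∧
      DiffSub.IsBestDominant {0}ᶜ 1 (fun r s _ => 1 + γ * (s / r))
        (fun z => 1 + γ * (z * deriv q z / q z)) q := by
  obtain ⟨hd, heq⟩ := hf.1.opF_spec hp hF γ
  have hbest := hq.isBestDominant hγ hq0 hqre
  obtain ⟨ω, hω, hωm, hω0, hωeq⟩ := hsub
  have hsol : DiffSub.IsSolution {0}ᶜ 1 (fun r s _ => 1 + γ * (s / r))
      (fun z => 1 + γ * (z * deriv q z / q z)) (DiffSub.opF p η μ f) :=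
    ⟨hd, hf.2.1, hF, ω, hω, hωm, hω0, fun z hz => (heq z hz).trans (hωeq z hz)⟩
  exact ⟨hbest.2.2.1.2 _ hsol, hsol, hbest⟩
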